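/- Let $R$ be an associative ring, not necessarily with unity, which is simple, that is, $R^2 \neq 0$ and the only two-sided ideals of $R$ are $0$ and $R$. Let $Z(R)$ be the center of $R$, write $[x,y] = xy - yx$, and let $[R,R]$ be the additive subgroup of $R$ generated by all $[x,y]$ with $x, y \in R$. Let $L$ be a Lie ideal of $R$, that is, an additive subgroup of $R$ such that $[x,r] \in L$ for all $x \in L$ and $r \in R$. Then at least one of the following holds: 1. $L \subseteq Z(R)$; 2. $L = Z(R)a + Z(R)$ for some $a \in L \setminus Z(R)$; 3. $[R,R] \subseteq L$. If moreover $R$ is not commutative, then exactly one of the three holds. -/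

import Mathlib

/-- An additive subgroup `L` of the (not necessarily unital) ring `R` is a Lie ideal of `R` if
`[x, r] = x * r - r * x` lies in `L` for all `x ∈ L` and `r ∈ R`. -/
def IsRingLieIdeal {R : Type*} [NonUnitalRing R] (L : AddSubgroup R) : Prop :=
  ∀ x ∈ L, ∀ r : R, x * r - r * x ∈ L

/-- `[A, B]`: the additive subgroup of `R` generated by all `[a, b] = a * b - b * a` with
`a ∈ A` and `b ∈ B`. -/
def addCommutatorSubgroup {R : Type*} [NonUnitalRing R] (A B : Set R) : AddSubgroup R :=
  AddSubgroup.closure {x : R | ∃ a ∈ A, ∃ b ∈ B, x = a * b - b * a}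

/-- The subset `Z(R) a + Z(R)` of `R`, where `Z(R)` is the center of `R`. -/
def centerMulAddCenter {R : Type*} [NonUnitalRing R] (a : R) : Set R :=
  {x : R | ∃ z ∈ NonUnitalSubring.center R, ∃ w ∈ NonUnitalSubring.center R, x = z * a + w}

/-- `R` is a simple ring: `R² ≠ 0`, and the only two-sided ideals of `R` are `0` and `R`. No unit
is required. -/
def IsSimpleNonUnital (R : Type*) [NonUnitalRing R] : Prop :=
  (∃ x y : R, x * y ≠ 0) ∧ ∀ I : TwoSidedIdeal R, I = ⊥ ∨ I = ⊤

section

variable {R : Type*} [NonUnitalRing R]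

/-! ### Ideals, commutators and center of a simple ring -/

namespace IsSimpleNonUnital

/-! Let T = {x | [x, R] ⊆ L}, a subring and a Lie ideal containing L. If T is not commutative, it
contains a nonzero ideal, so T = R and [R, R] ⊆ L (`mem_of_isRingLieIdeal`). If T is commutative,
then [a, [a, r]] = 0 for a in L, which makes a central unless 2R = 0. If 2R = 0 and L is not
central, some v = [a, x₀] with a in T has v² ≠ 0. As v² is central, R is unital, and rescaling x₀
gives [a, x] = 1. Then T = Za + Z (`exists_central_of_mem`), and L is all of T. -/

theorem eq_bot_or_eq_top (hR : IsSimpleNonUnital R) (I : AddSubgroup R)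
    (hl : ∀ r x, x ∈ I → r * x ∈ I) (hr : ∀ r x, x ∈ I → x * r ∈ I) :
    (∀ x ∈ I, x = 0) ∨ ∀ x, x ∈ I := by
  have key : ∀ x, x ∈ TwoSidedIdeal.mk' (I : Set R) I.zero_mem I.add_mem I.neg_mem
      (fun {x y} h => hl x y h) (fun {x y} h => hr y x h) ↔ x ∈ I := by
    intro x
    rw [TwoSidedIdeal.mem_mk']
    rfl
  rcases hR.2 (TwoSidedIdeal.mk' (I : Set R) I.zero_mem I.add_mem I.neg_mem
      (fun {x y} h => hl x y h) (fun {x y} h => hr y x h)) with h | h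
  · left
    intro x hx
    rw [← key, h] at hx
    exact (TwoSidedIdeal.mem_bot R).1 hx
  · right
    intro x
    rw [← key, h]
    exact trivial

theorem eq_zero_of_mul_right (hR : IsSimpleNonUnital R) {x : R} (hx : ∀ r, x * r = 0) :
    x = 0 := by
  let I : AddSubgroup R :=
    { carrier := {x | ∀ r, x * r = 0}
      zero_mem' := fun r => zero_mul r
      add_mem' := fun {a b} ha hb r => by rw [add_mul, ha r, hb r, add_zero]
      neg_mem' := fun {a} ha r => by rw [neg_mul, ha r, neg_zero] }
  rcases hR.eq_bot_or_eq_top I (fun r x hx s => by rw [mul_assoc, hx s, mul_zero])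
    (fun r x hx s => by rw [mul_assoc, hx]) with h | h
  · exact h x hx
  · obtain ⟨a, b, hab⟩ := hR.1
    exact absurd (h a b) hab

theorem eq_zero_of_mul_left (hR : IsSimpleNonUnital R) {x : R} (hx : ∀ r, r * x = 0) :
    x = 0 := by
  let I : AddSubgroup R :=
    { carrier := {x | ∀ r, r * x = 0}
      zero_mem' := fun r => mul_zero r
      add_mem' := fun {a b} ha hb r => by rw [mul_add, ha r, hb r, add_zero]
      neg_mem' := fun {a} ha r => by rw [mul_neg, ha r, neg_zero] }
  rcases hR.eq_bot_or_eq_top I (fun r x hx s => by rw [← mul_assoc, hx])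
    (fun r x hx s => by rw [← mul_assoc, hx s, zero_mul]) with h | h
  · exact h x hx
  · obtain ⟨a, b, hab⟩ := hR.1
    exact absurd (h b a) hab

theorem eq_zero_of_mul_mul_self (hR : IsSimpleNonUnital R) {a : R}
    (ha : ∀ r, a * r * a = 0) : a = 0 := by
  let I : AddSubgroup R :=
    { carrier := {x | ∀ r, x * r * a = 0}
      zero_mem' := fun r => by rw [zero_mul, zero_mul]
      add_mem' := fun {x y} hx hy r => by rw [add_mul, add_mul, hx r, hy r, add_zero]
      neg_mem' := fun {x} hx r => by rw [neg_mul, neg_mul, hx r, neg_zero] }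
  rcases hR.eq_bot_or_eq_top I
    (fun r x hx s => by rw [mul_assoc r, mul_assoc r, hx s, mul_zero])
    (fun r x hx s => by rw [mul_assoc x, hx]) with h | h
  · exact h a ha
  · refine hR.eq_zero_of_mul_left fun r => hR.eq_zero_of_mul_left fun s => ?_
    rw [← mul_assoc]
    exact h s r

theorem add_self_eq_zero_or (hR : IsSimpleNonUnital R) :
    (∀ x : R, x + x = 0) ∨ ∀ x : R, x + x = 0 → x = 0 := by
  let I : AddSubgroup R :=
    { carrier := {x | x + x = 0}
      zero_mem' := add_zero 0
      add_mem' := fun {x y} hx hy => by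
        change x + y + (x + y) = 0
        rw [add_add_add_comm, hx, hy, add_zero]
      neg_mem' := fun {x} hx => by
        change -x + -x = 0
        rw [← neg_add, hx, neg_zero] }
  exact (hR.eq_bot_or_eq_top I (fun r x hx => show r * x + r * x = 0 by
      rw [← mul_add, hx, mul_zero]) (fun r x hx => show x * r + x * r = 0 by
      rw [← add_mul, hx, zero_mul])).symm

/-- An element that commutes with all commutators is central. -/
theorem commute_of_commute_commutators (hR : IsSimpleNonUnital R) {a : R}
    (ha : ∀ x y, a * (x * y - y * x) = (x * y - y * x) * a) (x : R) : a * x = x * a := by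
  -- Because [x, xy] = x[x, y]. Replacing y by ya below gives [a, x] y [a, x] = 0.
  have h1 : ∀ y, (a * x - x * a) * (x * y - y * x) = 0 := by
    intro y
    have e1 := ha x (x * y)
    have e2 := congrArg (x * ·) (ha x y)
    simp only [mul_sub, sub_mul, mul_assoc] at e1 e2 ⊢
    linear_combination (norm := abel) e1 - e2
  rw [← sub_eq_zero]
  refine hR.eq_zero_of_mul_mul_self fun y => ?_
  have e1 := h1 (y * a)
  have e2 := congrArg (· * a) (h1 y)
  simp only [mul_sub, sub_mul, mul_assoc, zero_mul] at e1 e2 ⊢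
  linear_combination (norm := abel) e2 - e1

/-- Away from characteristic two, an element whose inner derivation squares to zero is central. -/
theorem commute_of_commute_commutator (hR : IsSimpleNonUnital R)
    (h2 : ∀ x : R, x + x = 0 → x = 0) {a : R}
    (ha : ∀ r, a * (a * r - r * a) = (a * r - r * a) * a) (x : R) : a * x = x * a := by
  -- By Leibniz, [a, [a, xy]] = 2[a, x][a, y].
  have h1 : ∀ y, (a * x - x * a) * (a * y - y * a) = 0 := by
    intro y
    apply h2
    have e1 := ha (x * y)
    have e2 := congrArg (x * ·) (ha y)
    have e3 := congrArg (· * y) (ha x)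
    simp only [mul_sub, sub_mul, mul_assoc] at e1 e2 e3 ⊢
    linear_combination (norm := abel) e1 - e2 - e3
  rw [← sub_eq_zero]
  refine hR.eq_zero_of_mul_mul_self fun y => ?_
  have e1 := h1 (y * x)
  have e2 := congrArg (· * x) (h1 y)
  simp only [mul_sub, sub_mul, mul_assoc, zero_mul] at e1 e2 ⊢
  linear_combination (norm := abel) e1 - e2

theorem eq_zero_of_central_mul (hR : IsSimpleNonUnital R) {z : R} (hz : ∀ r, r * z = z * r)
    (hz0 : z ≠ 0) {x : R} (hx : z * x = 0) : x = 0 := by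
  let I : AddSubgroup R :=
    { carrier := {x | z * x = 0}
      zero_mem' := mul_zero z
      add_mem' := fun {a b} ha hb => by
        change z * (a + b) = 0
        rw [mul_add, ha, hb, add_zero]
      neg_mem' := fun {a} ha => by
        change z * -a = 0
        rw [mul_neg, ha, neg_zero] }
  rcases hR.eq_bot_or_eq_top I
    (fun r x hx => show z * (r * x) = 0 by rw [← mul_assoc, ← hz, mul_assoc, hx, mul_zero])
    (fun r x hx => show z * (x * r) = 0 by rw [← mul_assoc, hx, zero_mul]) with h | h
  · exact h x hx
  · exact absurd (hR.eq_zero_of_mul_right h) hz0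

theorem exists_central_mul_eq (hR : IsSimpleNonUnital R) {z : R} (hz : ∀ r, r * z = z * r)
    (hz0 : z ≠ 0) (x : R) : ∃ y, z * y = x := by
  let I : AddSubgroup R :=
    { carrier := {x | ∃ y, z * y = x}
      zero_mem' := ⟨0, mul_zero z⟩
      add_mem' := by
        rintro _ _ ⟨a, rfl⟩ ⟨b, rfl⟩
        exact ⟨a + b, mul_add z a b⟩
      neg_mem' := by
        rintro _ ⟨a, rfl⟩
        exact ⟨-a, mul_neg z a⟩ }
  rcases hR.eq_bot_or_eq_top I
    (by rintro r _ ⟨y, rfl⟩; exact ⟨r * y, by rw [← mul_assoc, ← hz, mul_assoc]⟩)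
    (by rintro r _ ⟨y, rfl⟩; exact ⟨y * r, by rw [← mul_assoc]⟩) with h | h
  · exact absurd (hR.eq_zero_of_mul_right fun r => h _ ⟨r, rfl⟩) hz0
  · exact h x

theorem exists_one_of_central (hR : IsSimpleNonUnital R) {z : R} (hz : ∀ r, r * z = z * r)
    (hz0 : z ≠ 0) : ∃ e : R, (∀ x, e * x = x) ∧ ∀ x, x * e = x := by
  obtain ⟨e, he⟩ := hR.exists_central_mul_eq hz hz0 z
  refine ⟨e, fun x => ?_, fun x => ?_⟩
  · refine sub_eq_zero.1 (hR.eq_zero_of_central_mul hz hz0 ?_)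
    rw [mul_sub, ← mul_assoc, he, sub_self]
  · refine sub_eq_zero.1 (hR.eq_zero_of_central_mul hz hz0 ?_)
    rw [mul_sub, ← mul_assoc, ← hz, mul_assoc, he, sub_self]

theorem exists_central_inverse (hR : IsSimpleNonUnital R) {z : R} (hz : ∀ r, r * z = z * r)
    (hz0 : z ≠ 0) {e : R} (he : ∀ x, e * x = x) (he' : ∀ x, x * e = x) :
    ∃ w, z * w = e ∧ ∀ r, r * w = w * r := by
  obtain ⟨w, hw⟩ := hR.exists_central_mul_eq hz hz0 e
  refine ⟨w, hw, fun r => sub_eq_zero.1 (hR.eq_zero_of_central_mul hz hz0 ?_)⟩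
  rw [mul_sub, ← mul_assoc, ← hz, mul_assoc, hw, ← mul_assoc, hw, he, he', sub_self]

/-- A noncommutative subring that is a Lie ideal is the whole simple ring. -/
theorem mem_of_isRingLieIdeal (hR : IsSimpleNonUnital R) {S : NonUnitalSubring R}
    (hS : ∀ x ∈ S, ∀ r : R, x * r - r * x ∈ S) {a b : R} (ha : a ∈ S) (hb : b ∈ S)
    (hab : a * b ≠ b * a) (x : R) : x ∈ S := by
  -- The largest two-sided ideal of R inside S; it contains [a, b] because [a, b]r = [a, br] - b[a,
  -- r].
  let I : AddSubgroup R :=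
    { carrier := {p | p ∈ S ∧ (∀ r, p * r ∈ S) ∧ (∀ r, r * p ∈ S) ∧ ∀ r s, r * p * s ∈ S}
      zero_mem' := by simp [S.zero_mem]
      add_mem' := by
        rintro x y ⟨h1, h2, h3, h4⟩ ⟨k1, k2, k3, k4⟩
        refine ⟨add_mem h1 k1, fun r => ?_, fun r => ?_, fun r s => ?_⟩
        · rw [add_mul]; exact add_mem (h2 r) (k2 r)
        · rw [mul_add]; exact add_mem (h3 r) (k3 r)
        · rw [mul_add, add_mul]; exact add_mem (h4 r s) (k4 r s)
      neg_mem' := by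
        rintro x ⟨h1, h2, h3, h4⟩
        refine ⟨neg_mem h1, fun r => ?_, fun r => ?_, fun r s => ?_⟩
        · rw [neg_mul]; exact neg_mem (h2 r)
        · rw [mul_neg]; exact neg_mem (h3 r)
        · rw [mul_neg, neg_mul]; exact neg_mem (h4 r s) }
  have hc : ∀ r, (a * b - b * a) * r ∈ S := fun r => by
    have := sub_mem (hS a ha (b * r)) (mul_mem hb (hS a ha r))
    convert this using 1
    simp only [mul_sub, sub_mul, mul_assoc]
    abel
  have hcS : a * b - b * a ∈ S := hS a ha b
  have hI : a * b - b * a ∈ I := by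
    refine ⟨hcS, hc, fun r => ?_, fun r s => ?_⟩
    · have := sub_mem (hc r) (hS _ hcS r)
      rwa [sub_sub_cancel] at this
    · have := sub_mem (hc (s * r)) (hS _ (hc s) r)
      rwa [mul_assoc _ s r, sub_sub_cancel, ← mul_assoc] at this
  rcases hR.eq_bot_or_eq_top I
    (by
      rintro r x ⟨h1, h2, h3, h4⟩
      refine ⟨h3 r, h4 r, fun s => ?_, fun s t => ?_⟩
      · rw [← mul_assoc]; exact h3 _
      · rw [← mul_assoc]; exact h4 _ _)
    (by
      rintro r x ⟨h1, h2, h3, h4⟩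
      refine ⟨h2 r, fun s => ?_, fun s => ?_, fun s t => ?_⟩
      · rw [mul_assoc]; exact h2 _
      · rw [← mul_assoc]; exact h4 _ _
      · rw [← mul_assoc, mul_assoc _ r]; exact h4 _ _) with h | h
  · exact absurd (sub_eq_zero.1 (h _ hI)) hab
  · exact (h x).1

/-- A noncentral commutative Lie ideal of a simple ring has a commutator that is not
square-zero. -/
theorem exists_commutator_mul_self_ne_zero (hR : IsSimpleNonUnital R) {S : AddSubgroup R}
    (hS : IsRingLieIdeal S) (hcomm : ∀ a ∈ S, ∀ b ∈ S, a * b = b * a)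
    {a y : R} (ha : a ∈ S) (hay : a * y ≠ y * a) :
    ∃ b ∈ S, ∃ x, (b * x - x * b) * (b * x - x * b) ≠ 0 := by
  by_contra! H
  obtain ⟨c, hc⟩ : ∃ c, c = a * y - y * a := ⟨_, rfl⟩
  have hcS : c ∈ S := hc ▸ hS a ha y
  have hcc : c * c = 0 := hc ▸ H a ha y
  have hccl : ∀ t, c * (c * t) = 0 := fun t => by rw [← mul_assoc, hcc, zero_mul]
  -- Multiplying [c, x]² = 0 on the left by c, where c² = 0, leaves only this term.
  have h1 : ∀ x, c * x * c * x * c = 0 := fun x => by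
    have := congrArg (c * ·) (H c hcS x)
    simpa only [mul_sub, sub_mul, mul_assoc, hccl, hcc, mul_zero, sub_zero, zero_sub, neg_neg,
      sub_neg_eq_add, zero_add] using this
  have h2 : ∀ x y, c * x * c * y * c = c * y * c * x * c := fun x y => by
    have := congrArg (c * ·) (hcomm _ (hS c hcS x) _ (hS c hcS y))
    simpa only [mul_sub, sub_mul, mul_assoc, hccl, hcc, mul_zero, sub_zero, zero_sub, neg_neg,
      sub_neg_eq_add, zero_add] using this
  refine hay (sub_eq_zero.1 (hc ▸ hR.eq_zero_of_mul_mul_self fun x =>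
    hR.eq_zero_of_mul_mul_self fun t => ?_))
  calc c * x * c * t * (c * x * c) = (c * x * c * t * c) * x * c := by simp only [mul_assoc]
    _ = c * t * (c * x * c * x * c) := by rw [h2 x t]; simp only [mul_assoc]
    _ = 0 := by rw [h1, mul_zero]

end IsSimpleNonUnital

/-- Expand 0 = [a, [a, r]] = a²r - 2ara + ra². -/
theorem IsRingLieIdeal.commute_mul_self {S : AddSubgroup R} (hS : IsRingLieIdeal S)
    (h2 : ∀ x : R, x + x = 0) (hcomm : ∀ a ∈ S, ∀ b ∈ S, a * b = b * a)
    {a : R} (ha : a ∈ S) (r : R) : r * (a * a) = a * a * r := by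
  have e1 := hcomm a ha _ (hS a ha r)
  have e2 := h2 (a * r * a)
  have e3 := h2 (r * (a * a))
  simp only [mul_sub, sub_mul, mul_assoc] at e1 e2 e3 ⊢
  linear_combination (norm := abel) e3 - e1 - e2

/-! ### Commutative Lie ideals with [a, x] = 1 -/

section Darboux

variable {S : AddSubgroup R} {a x e : R}

/-- Here r = [a, x]r = [a, xr]. -/
theorem IsRingLieIdeal.mem_of_commute (hS : IsRingLieIdeal S) (he : ∀ r : R, e * r = r)
    (ha : a ∈ S) (hax : a * x - x * a = e) {r : R} (hr : a * r = r * a) : r ∈ S := by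
  have := hS a ha (x * r)
  rwa [mul_assoc x, ← hr, ← mul_assoc, ← mul_assoc, ← sub_mul, hax, he] at this

/-- R = S + xS, since r - x[a, r] commutes with a and so lies in S. -/
theorem IsRingLieIdeal.central_of_commute (hS : IsRingLieIdeal S)
    (hcomm : ∀ a ∈ S, ∀ b ∈ S, a * b = b * a) (he : ∀ r : R, e * r = r) (ha : a ∈ S)
    (hax : a * x - x * a = e) {k : R} (hk : k ∈ S) (hkx : k * x = x * k) (r : R) :
    r * k = k * r := by
  have h1 := hS a ha r
  have h2 : r - x * (a * r - r * a) ∈ S := by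
    refine hS.mem_of_commute he ha hax ?_
    have e1 := congrArg (x * ·) (hcomm a ha _ h1)
    have e2 : (a * x - x * a) * (a * r - r * a) = a * r - r * a := by rw [hax, he]
    simp only [mul_sub, sub_mul, mul_assoc] at e1 e2 ⊢
    linear_combination (norm := abel) -e1 - e2
  have h3 := hcomm k hk _ h1
  have h4 := hcomm k hk _ h2
  rw [mul_sub, sub_mul, ← mul_assoc, hkx, mul_assoc x k, h3, ← mul_assoc] at h4
  exact (sub_left_inj.1 h4).symm

/-- The commutative Lie ideal `S` is spanned over the center by `1` and `a` as soon as `[a, x]` is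
the identity. -/
theorem IsRingLieIdeal.exists_central_of_mem (hS : IsRingLieIdeal S) (h2 : ∀ x : R, x + x = 0)
    (hcomm : ∀ a ∈ S, ∀ b ∈ S, a * b = b * a) (he : ∀ r : R, e * r = r)
    (he' : ∀ r : R, r * e = r) (ha : a ∈ S) (hax : a * x - x * a = e) {s : R} (hs : s ∈ S) :
    ∃ c w, (∀ r, r * c = c * r) ∧ (∀ r, r * w = w * r) ∧ s = c * a + w := by
  have hxx : x * x ∈ S := by
    refine hS.mem_of_commute he ha hax (sub_eq_zero.1 ?_)
    have e1 : (a * x - x * a) * x + x * (a * x - x * a) = 0 := by rw [hax, he, he', h2]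
    rw [← e1]
    simp only [mul_sub, sub_mul, mul_assoc]
    abel
  -- The coefficient of a is c = [s, x]: from [s, x²] = 0 it commutes with x, hence is central, and
  -- w = s - ca satisfies [w, x] = 0.
  have hcS := hS s hs x
  have hc : ∀ r, r * (s * x - x * s) = (s * x - x * s) * r := by
    refine hS.central_of_commute hcomm he ha hax hcS ?_
    have e1 := hcomm s hs _ hxx
    have e2 := h2 (x * s * x)
    have e3 := h2 (x * x * s)
    simp only [mul_sub, sub_mul, mul_assoc] at e1 e2 e3 ⊢
    linear_combination (norm := abel) e1 - e2 + e3
  have hwS : s - (s * x - x * s) * a ∈ S := by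
    refine hS.mem_of_commute he ha hax ?_
    generalize s * x - x * s = c at hc ⊢
    rw [mul_sub, sub_mul, hcomm a ha s hs, ← mul_assoc a, hc a]
  refine ⟨s * x - x * s, s - (s * x - x * s) * a, hc,
    hS.central_of_commute hcomm he ha hax hwS (sub_eq_zero.1 ?_), (add_sub_cancel _ _).symm⟩
  calc (s - (s * x - x * s) * a) * x - x * (s - (s * x - x * s) * a)
      = s * x - x * s - ((s * x - x * s) * (a * x) - x * (s * x - x * s) * a) := by
        simp only [mul_sub, sub_mul, mul_assoc]
        abel
    _ = s * x - x * s - (s * x - x * s) * (a * x - x * a) := by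
        rw [hc x, mul_sub (s * x - x * s) (a * x), mul_assoc (s * x - x * s) x a]
    _ = 0 := by rw [hax, he', sub_self]

end Darboux

/-! ### The idealizer and the trichotomy -/

/-- The elements of `R` all of whose commutators lie in the Lie ideal `L`. -/
def IsRingLieIdeal.idealizer {L : AddSubgroup R} (_hL : IsRingLieIdeal L) :
    NonUnitalSubring R where
  carrier := {x | ∀ r, x * r - r * x ∈ L}
  zero_mem' r := by simp [L.zero_mem]
  add_mem' {x y} hx hy r := by
    have := add_mem (hx r) (hy r)
    convert this using 1
    rw [add_mul, mul_add]
    abel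
  neg_mem' {x} hx r := by
    have := neg_mem (hx r)
    convert this using 1
    rw [neg_mul, mul_neg]
    abel
  mul_mem' {x y} hx hy r := by
    have := add_mem (hx (y * r)) (hy (r * x))
    convert this using 1
    simp only [mul_assoc]
    abel

theorem IsSimpleNonUnital.lieIdeal_trichotomy (hR : IsSimpleNonUnital R) {L : AddSubgroup R}
    (hL : IsRingLieIdeal L) :
    (L : Set R) ⊆ NonUnitalSubring.center R ∨
      (∃ a ∈ L, a ∉ NonUnitalSubring.center R ∧ (L : Set R) = centerMulAddCenter a) ∨
      addCommutatorSubgroup (Set.univ : Set R) Set.univ ≤ L := by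
  have hLS : ∀ x ∈ L, x ∈ hL.idealizer := fun x hx => hL x hx
  have hS : IsRingLieIdeal hL.idealizer.toAddSubgroup := fun x hx r => hLS _ (hx r)
  by_cases hcomm : ∀ a ∈ hL.idealizer.toAddSubgroup, ∀ b ∈ hL.idealizer.toAddSubgroup,
      a * b = b * a
  swap
  · push Not at hcomm
    obtain ⟨a, ha, b, hb, hab⟩ := hcomm
    right; right
    refine (AddSubgroup.closure_le L).2 ?_
    rintro _ ⟨x, -, y, -, rfl⟩
    exact hR.mem_of_isRingLieIdeal hS ha hb hab x y
  rcases hR.add_self_eq_zero_or with h2 | h2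
  swap
  · left
    intro a ha
    exact NonUnitalSubring.mem_center_iff.2 fun r => (hR.commute_of_commute_commutator h2
      (fun s => hcomm a (hLS a ha) _ (hS a (hLS a ha) s)) r).symm
  by_cases hLZ : (L : Set R) ⊆ NonUnitalSubring.center R
  · exact Or.inl hLZ
  right; left
  obtain ⟨u, hu, huZ⟩ := Set.not_subset.1 hLZ
  refine ⟨u, hu, huZ, ?_⟩
  have huZ' := huZ
  rw [SetLike.mem_coe, NonUnitalSubring.mem_center_iff] at huZ'
  push Not at huZ'
  obtain ⟨y, hy⟩ := huZ'
  obtain ⟨a, ha, x₀, hx₀⟩ :=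
    hR.exists_commutator_mul_self_ne_zero hS hcomm (hLS u hu) hy.symm
  have hvS := hS a ha x₀
  have hz := hS.commute_mul_self h2 hcomm hvS
  obtain ⟨e, he, he'⟩ := hR.exists_one_of_central hz hx₀
  obtain ⟨z', hz', hz'c⟩ := hR.exists_central_inverse hz hx₀ he he'
  obtain ⟨x, hax⟩ : ∃ x, a * x - x * a = e := by
    -- As v = [a, x₀] commutes with a, [a, x₀vz'] = v²z' = e.
    refine ⟨x₀ * ((a * x₀ - x₀ * a) * z'), ?_⟩
    have h1 : (a * x₀ - x₀ * a) * z' * a = a * ((a * x₀ - x₀ * a) * z') := by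
      rw [mul_assoc, ← hz'c, ← mul_assoc, ← hcomm a ha _ hvS, mul_assoc]
    rw [mul_assoc x₀, h1, ← mul_assoc, ← mul_assoc x₀, ← sub_mul, ← mul_assoc, hz']
  obtain ⟨c, w, hc, hw, hucw⟩ :=
    hS.exists_central_of_mem h2 hcomm he he' ha hax (hLS u hu)
  have hc0 : c ≠ 0 := by
    rintro rfl
    rw [zero_mul, zero_add] at hucw
    exact huZ (NonUnitalSubring.mem_center_iff.2 (hucw ▸ hw))
  obtain ⟨c', hc', hc'c⟩ := hR.exists_central_inverse hc hc0 he he'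
  have hcc' : c' * c = e := by rw [← hc', hc]
  ext t
  constructor
  · intro ht
    obtain ⟨d, v, hd, hv, htdv⟩ :=
      hS.exists_central_of_mem h2 hcomm he he' ha hax (hLS t ht)
    have hcen : ∀ {z : R}, (∀ r, r * z = z * r) → z ∈ NonUnitalSubring.center R :=
      fun h => NonUnitalSubring.mem_center_iff.2 h
    refine ⟨d * c', mul_mem (hcen hd) (hcen hc'c), v - d * c' * w,
      sub_mem (hcen hv) (mul_mem (mul_mem (hcen hd) (hcen hc'c)) (hcen hw)), ?_⟩
    rw [hucw, htdv, mul_add, ← mul_assoc (d * c'), mul_assoc d c' c, hcc', he']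
    abel
  · rintro ⟨d, hd, v, hv, rfl⟩
    rw [NonUnitalSubring.mem_center_iff] at hd hv
    have hat : a * (d * u + v) = (d * u + v) * a := by
      rw [mul_add, add_mul, ← mul_assoc, hd a, mul_assoc, hcomm a ha u (hLS u hu), hv a,
        mul_assoc]
    -- With t = du + v commuting with a and u = ca + w, [u, c'xt] = [a, xt] = t, so t lies in L
    -- itself.
    have key := hL u hu (c' * (x * (d * u + v)))
    generalize d * u + v = t at hat key ⊢
    have h1 : u * (c' * (x * t)) - c' * (x * t) * u = a * (x * t) - x * t * a := by
      have h3 : w * (c' * (x * t)) = c' * (x * t) * w := (hw _).symm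
      have h4 : c * a * (c' * (x * t)) = a * (x * t) := by
        rw [← mul_assoc, mul_assoc c, hc'c, ← mul_assoc c, hc', he]
      have h5 : c' * (x * t) * (c * a) = x * t * a := by
        rw [← mul_assoc, mul_assoc c', hc, ← mul_assoc, hcc', he]
      rw [hucw, add_mul, mul_add, h3, h4, h5]
      abel
    rw [h1, mul_assoc x, ← hat, ← mul_assoc, ← mul_assoc, ← sub_mul, hax, he] at key
    exact key

/-! ### Mutual exclusion -/

theorem centerMulAddCenter_commute {a x y : R} (hx : x ∈ centerMulAddCenter a)
    (hy : y ∈ centerMulAddCenter a) : x * y = y * x := by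
  obtain ⟨z, hz, w, hw, rfl⟩ := hx
  obtain ⟨z', hz', w', hw', rfl⟩ := hy
  rw [NonUnitalSubring.mem_center_iff] at hz hw hz' hw'
  have h1 : z * a * (z' * a) = z' * a * (z * a) := by
    rw [← mul_assoc, hz', mul_assoc, mul_assoc, mul_assoc, ← mul_assoc a z, hz, mul_assoc]
  rw [mul_add, add_mul, add_mul, mul_add, add_mul, add_mul, h1, hw (z' * a), hw' (z * a), hw w']
  abel

end

/-- Trichotomy for a Lie ideal `L` of a simple ring `R`; the three cases exclude each other as
soon as `R` is not commutative. -/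
theorem theoremA {R : Type*} [NonUnitalRing R] (hR : IsSimpleNonUnital R)
    (L : AddSubgroup R) (hL : IsRingLieIdeal L) :
    ((L : Set R) ⊆ NonUnitalSubring.center R ∨
      (∃ a ∈ L, a ∉ NonUnitalSubring.center R ∧ (L : Set R) = centerMulAddCenter a) ∨
      addCommutatorSubgroup (Set.univ : Set R) Set.univ ≤ L) ∧
    ((∃ x y : R, x * y ≠ y * x) →
      ¬ ((L : Set R) ⊆ NonUnitalSubring.center R ∧
          ∃ a ∈ L, a ∉ NonUnitalSubring.center R ∧ (L : Set R) = centerMulAddCenter a) ∧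
      ¬ ((L : Set R) ⊆ NonUnitalSubring.center R ∧
          addCommutatorSubgroup (Set.univ : Set R) Set.univ ≤ L) ∧
      ¬ ((∃ a ∈ L, a ∉ NonUnitalSubring.center R ∧ (L : Set R) = centerMulAddCenter a) ∧
          addCommutatorSubgroup (Set.univ : Set R) Set.univ ≤ L)) := by
  refine ⟨hR.lieIdeal_trichotomy hL, ?_⟩
  rintro ⟨x, y, hxy⟩
  have hmem : ∀ {K : AddSubgroup R}, addCommutatorSubgroup (Set.univ : Set R) Set.univ ≤ K →
      ∀ p q : R, p * q - q * p ∈ K :=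
    fun h p q => h (AddSubgroup.subset_closure ⟨p, trivial, q, trivial, rfl⟩)
  refine ⟨?_, ?_, ?_⟩
  · rintro ⟨h, a, ha, haZ, -⟩
    exact haZ (h ha)
  · rintro ⟨h, hc⟩
    exact hxy (hR.commute_of_commute_commutators
      (fun p q => NonUnitalSubring.mem_center_iff.1 (h (hmem hc p q)) x) y)
  · rintro ⟨⟨a, -, -, hLa⟩, hc⟩
    have hin : ∀ p q : R, p * q - q * p ∈ centerMulAddCenter a := fun p q => by
      rw [← hLa]
      exact hmem hc p q
    -- Commutators commute with each other, hence are central, hence R is commutative.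
    exact hxy (hR.commute_of_commute_commutators (fun p q =>
      (hR.commute_of_commute_commutators
        (fun p' q' => centerMulAddCenter_commute (hin p q) (hin p' q')) x).symm) y)
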